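/- For $x=[x_0:\dots:x_N]\in\mathbb P^N(\overline{\mathbb Q})$ with coordinates in a number field $K$, let $$h(x)=\sum_{v\in M_K}\frac{[K_v:\mathbb Q_v]}{[K:\mathbb Q]}\log\max_i|x_i|_v$$ be the absolute logarithmic Weil height. For $f=f_1/f_0\in\overline{\mathbb Q}(z)$ in lowest terms, let $\deg f=\max(\deg f_1,\deg f_0)$ and let $h(f)$ be the height of the tuple of all coefficients of $f_1$ and $f_0$. For $R=P/Q\in\overline{\mathbb Q}(z,w)$ with $P,Q\in\overline{\mathbb Q}[z,w]$ without common factor, let $\deg_wR=\max(\deg_wP,\deg_wQ)$, $\deg_zR=\max(\deg_zP,\deg_zQ)$, let $h(R)$ be the height of the tuple of all coefficients of $P$ and $Q$, and let $\operatorname{Res}(P,Q)\in\overline{\mathbb Q}[z]$ be the resultant with respect to $w$ of $P$ and $Q$, both regarded as forms of degree $\deg_wR$ (a Sylvester determinant of size $2\deg_wR$). **Lemma.** Let $R=P/Q\in\overline{\mathbb Q}(z,w)$ with $d=\deg_wR\ge 2$, and let $f\in\overline{\mathbb Q}(z)$ be such that $R(z,f(z))$ is defined, i.e. $Q(z,f(z))\ne0$.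 Then $$d\,h(f)\le h\big(R(z,f(z))\big)+C(R,\deg f),$$ where the error term depends only on $R$ and $\deg f$, and is given explicitly by $$C(R,k)=(2d-1)\,h(R)+\Big(\deg\operatorname{Res}(P,Q)+4d\deg_zR+(6d-3)k+1\Big)\log2+\log\,(2d-1)!\,.$$ -/

import Mathlib

open Polynomial

noncomputable section

/-- The field of algebraic numbers. -/
abbrev Qbar : Type := AlgebraicClosure ℚ

namespace WeilHeight

instance qbar_isAlgebraic : Algebra.IsAlgebraic ℚ Qbar := AlgebraicClosure.isAlgebraic ℚ

/-- The number field generated by the coordinates of a finite tuple of algebraic numbers. -/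
abbrev coordField {ι : Type} (x : ι → Qbar) : IntermediateField ℚ Qbar :=
  IntermediateField.adjoin ℚ (Set.range x)

instance coordField_numberField {ι : Type} [Finite ι] (x : ι → Qbar) :
    NumberField (coordField x) where
  to_finiteDimensional := by
    have : Finite (Set.range x) := Set.finite_range x
    exact IntermediateField.finiteDimensional_adjoin
      fun y _ => (Algebra.IsAlgebraic.isAlgebraic (R := ℚ) y).isIntegral

/-- The absolute logarithmic Weil height `h([x])` of the projective point whose homogeneous
coordinates are the algebraic numbers `x i` (not all zero). `Height.logHeight` is the sum over the
places `v` of the number field `K` of `[K_v : ℚ_v] * log (max_i |x i|_v)`, which is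
divided here by `[K : ℚ]`. -/
def absLogHeight {ι : Type} [Finite ι] (x : ι → Qbar) : ℝ :=
  Height.logHeight (fun i => (⟨x i, IntermediateField.subset_adjoin ℚ _ ⟨i, rfl⟩⟩ : coordField x))
    / (Module.finrank ℚ (coordField x) : ℝ)

/-! ### Rational functions of one variable `z` -/

/-- The degree of a rational function `f(z)`: the maximum of the degrees of its numerator and
denominator in lowest terms. -/
def ratDegree (f : RatFunc Qbar) : ℕ := max f.num.natDegree f.denom.natDegree

/-- The tuple `(c_0, …, c_k; c_{k+1}, …, c_{2k+1})` of the coefficients of the numerator and of the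
denominator of `f` in lowest terms, with `k = deg f`. -/
def ratCoeffs (f : RatFunc Qbar) :
    Fin (ratDegree f + 1) ⊕ Fin (ratDegree f + 1) → Qbar :=
  Sum.elim (fun i => f.num.coeff i) (fun i => f.denom.coeff i)

/-- The height `h(f)` of a rational function: the Weil height of its tuple of coefficients. -/
def ratHeight (f : RatFunc Qbar) : ℝ := absLogHeight (ratCoeffs f)

/-! ### Rational functions of two variables `z, w`

In `Qbar[X][X]` the inner variable is `z` and the outer variable is `w`. -/

/-- The field `Qbar(z, w)`, as the field of fractions of the factorial ring `Qbar[z][w]`. -/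
abbrev RatFunc₂ : Type := FractionRing (Qbar[X][X])

/-- The numerator of `R(z, w)` in lowest terms (in the factorial ring `Qbar[z][w]`, so determined
together with the denominator up to a common nonzero constant). -/
def num₂ (R : RatFunc₂) : Qbar[X][X] := IsFractionRing.num (Qbar[X][X]) R

/-- The denominator of `R(z, w)` in lowest terms. -/
def den₂ (R : RatFunc₂) : Qbar[X][X] := (IsFractionRing.den (Qbar[X][X]) R : Qbar[X][X])

/-- `deg_w F` for a polynomial `F(z, w)`. -/
def polyDegW (F : Qbar[X][X]) : ℕ := F.natDegree

/-- `deg_z F` for a polynomial `F(z, w)`. -/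
def polyDegZ (F : Qbar[X][X]) : ℕ := F.support.sup fun j => (F.coeff j).natDegree

/-- `deg_w R`, the degree of `R` as a rational function of `w`. -/
def degW (R : RatFunc₂) : ℕ := max (polyDegW (num₂ R)) (polyDegW (den₂ R))

/-- `deg_z R`, the degree of `R` as a rational function of `z`. -/
def degZ (R : RatFunc₂) : ℕ := max (polyDegZ (num₂ R)) (polyDegZ (den₂ R))

/-- The coefficients of the numerator and of the denominator of `R` in lowest terms; the entry of
index `(j, i)` is the coefficient of `w ^ j * z ^ i`. -/
def coeffs₂ (R : RatFunc₂) :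
    (Fin (degW R + 1) × Fin (degZ R + 1)) ⊕ (Fin (degW R + 1) × Fin (degZ R + 1)) → Qbar :=
  Sum.elim (fun p => ((num₂ R).coeff p.1).coeff p.2) (fun p => ((den₂ R).coeff p.1).coeff p.2)

/-- The height `h(R)`: the Weil height of the tuple of coefficients of `R`. -/
def height₂ (R : RatFunc₂) : ℝ := absLogHeight (coeffs₂ R)

/-- The resultant with respect to `w` of the numerator and denominator of `R`, both regarded as
forms of degree `d = deg_w R` (a `2d × 2d` Sylvester determinant, an element of `Qbar[z]`). -/
def res₂ (R : RatFunc₂) : Qbar[X] := resultant (num₂ R) (den₂ R) (degW R) (degW R)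

/-- `F(z, f(z))` for a polynomial `F(z, w)`. -/
def polySubst (F : Qbar[X][X]) (f : RatFunc Qbar) : RatFunc Qbar := aeval f F

/-- `R(z, f(z))`, meaningful when the denominator of `R` does not vanish at `w = f(z)`. -/
def subst₂ (R : RatFunc₂) (f : RatFunc Qbar) : RatFunc Qbar :=
  polySubst (num₂ R) f / polySubst (den₂ R) f

/-- The explicit error term; it depends only on `R` and on the degree `k` of `f`. -/
def heightError (R : RatFunc₂) (k : ℕ) : ℝ :=
  (2 * (degW R : ℝ) - 1) * height₂ R
    + (((res₂ R).natDegree : ℝ) + 4 * (degW R : ℝ) * (degZ R : ℝ)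
        + (6 * (degW R : ℝ) - 3) * (k : ℝ) + 1) * Real.log 2
    + Real.log ((Nat.factorial (2 * degW R - 1) : ℕ) : ℝ)

end WeilHeight

end

/-!
Write `R = P / Q` with `d = deg_w R`, `f = A / B` and `R(z, f(z)) = g₁ / g₀` in lowest terms, and
let `G` be the polynomial in `z` with `P(A, B) = G * g₁` and `Q(A, B) = G * g₀`, where `P` and `Q`
are homogenized to degree `d` in `w`. The rows of the Sylvester matrix of `P` and `Q`, combined
with the monomials `A ^ i * B ^ (2 * d - 1 - i)` as coefficients, give multiples of `P(A, B)` and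
`Q(A, B)`. Cramer's rule then writes each `Res(P, Q) * A ^ i * B ^ (2 * d - 1 - i)` as `G` times
the determinant of the Sylvester matrix with one row replaced by a row linear in `g₁, g₀`
(`resultant_mul_eq`). As `A` and `B` are coprime, `G` divides `Res(P, Q)`, which is nonzero by
Gauss's lemma (`res₂_ne_zero`). So with `S = Res(P, Q) / G ≠ 0` the polynomials
`S * A ^ (2 * d - 1)` and `S * B ^ (2 * d - 1)` are determinants whose entries are controlled by
`P, Q, A, B, g₁, g₀` (`exists_elim`).

At a nonarchimedean place the Gauss norm is multiplicative, and at an archimedean place the Mahler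
measure is; the latter is bounded by the sum of the absolute values of the coefficients, which is
submultiplicative. In the determinant, one of the unreplaced rows has only two nonzero entries,
which leaves at most `2 * (2 * d - 1)!` terms; this saving keeps the constant small enough even for
constant `f` and `R` with constant coefficients. The result bounds
`|c|_v * |f|_v ^ d` by a constant times `|R|_v ^ (2 * d - 1) * |(g₁, g₀)|_v`, where `|·|_v` is the
maximum of the coefficients and `c` is the leading coefficient of `S`
(`archimedean_estimate`, `nonarchimedean_estimate`). Multiplying over all places of a number field
that contains all coefficients, `c` disappears by the product formula (`mulHeight_pow_le`).

The heights in question are defined in different number fields, so the height of a tuple has to be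
independent of the field used (`absLogHeight_eq`). This is the formula
`H_L(x) = H_K(x) ^ [L : K]` for an extension `L / K` (`mulHeight_extension`).
-/

namespace WeilHeight

/-! ### Determinants and seminorms -/

lemma seminorm_det_le {R : Type*} [CommRing R] {n : ℕ} (N : RingSeminorm R) (h1 : N 1 ≤ 1)
    (A : Matrix (Fin n) (Fin n) R) (c : Fin n → ℝ) (hA : ∀ i j, N (A i j) ≤ c i) :
    N A.det ≤ n.factorial * ∏ i, c i := by
  induction n with
  | zero => simpa using h1
  | succ n ih =>
    have hc (i) : 0 ≤ c i := (apply_nonneg N _).trans (hA i 0)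
    rw [Matrix.det_succ_row_zero]
    calc N _ ≤ ∑ j : Fin (n + 1), N ((-1) ^ (j : ℕ) * A 0 j *
              (A.submatrix Fin.succ j.succAbove).det) :=
          Finset.le_sum_of_subadditive N (map_zero N).le (map_add_le_add N) _ _
      _ ≤ ∑ _j : Fin (n + 1), n.factorial * ∏ i, c i := by
          refine Finset.sum_le_sum fun j _ => ?_
          have hsign : N ((-1) ^ (j : ℕ) * A 0 j * (A.submatrix Fin.succ j.succAbove).det) =
              N (A 0 j * (A.submatrix Fin.succ j.succAbove).det) := by
            rcases neg_one_pow_eq_or R (j : ℕ) with h | h <;> simp [h, map_neg_eq_map]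
          rw [hsign]
          have := ih (A.submatrix Fin.succ j.succAbove) (fun i => c i.succ)
            (fun i k => hA _ _)
          calc _ ≤ N (A 0 j) * N (A.submatrix Fin.succ j.succAbove).det := map_mul_le_mul N _ _
            _ ≤ c 0 * (n.factorial * ∏ i : Fin n, c i.succ) := by
                gcongr
                · exact hc 0
                · exact hA 0 j
            _ = _ := by rw [Fin.prod_univ_succ]; ring
      _ = _ := by
          simp [Nat.factorial_succ]
          ring

/-- A row with at most two nonzero entries lowers the number of permutations that contribute to the
determinant from `(n + 1)!` to `2 * n!`. -/
lemma seminorm_det_le_of_sparse_row {R : Type*} [CommRing R] {n : ℕ} (N : RingSeminorm R)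
    (h1 : N 1 ≤ 1) (A : Matrix (Fin (n + 1)) (Fin (n + 1)) R) (c : Fin (n + 1) → ℝ)
    (hA : ∀ i j, N (A i j) ≤ c i) (r j₁ j₂ : Fin (n + 1))
    (hr : ∀ j, j ≠ j₁ → j ≠ j₂ → A r j = 0) :
    N A.det ≤ 2 * n.factorial * ∏ i, c i := by
  have hc (i) : 0 ≤ c i := (apply_nonneg N _).trans (hA i 0)
  have hterm (j : Fin (n + 1)) : N ((-1) ^ ((r : ℕ) + j) * A r j *
      (A.submatrix r.succAbove j.succAbove).det) ≤ n.factorial * ∏ i, c i := by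
    have hsign : N ((-1) ^ ((r : ℕ) + j) * A r j * (A.submatrix r.succAbove j.succAbove).det) =
        N (A r j * (A.submatrix r.succAbove j.succAbove).det) := by
      rcases neg_one_pow_eq_or R ((r : ℕ) + j) with h | h <;> simp [h, map_neg_eq_map]
    rw [hsign]
    have := seminorm_det_le N h1 (A.submatrix r.succAbove j.succAbove)
      (fun i => c (r.succAbove i)) (fun i k => hA _ _)
    calc _ ≤ N (A r j) * N (A.submatrix r.succAbove j.succAbove).det := map_mul_le_mul N _ _
      _ ≤ c r * (n.factorial * ∏ i : Fin n, c (r.succAbove i)) := by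
          gcongr
          · exact hc r
          · exact hA r j
      _ = _ := by rw [Fin.prod_univ_succAbove _ r]; ring
  have hnn : 0 ≤ n.factorial * ∏ i, c i := by
    have := Finset.prod_nonneg fun i (_ : i ∈ Finset.univ) => hc i
    positivity
  rw [Matrix.det_succ_row A r,
    ← Finset.sum_subset (Finset.subset_univ ({j₁, j₂} : Finset (Fin (n + 1))))]
  · calc N _ ≤ ∑ j ∈ ({j₁, j₂} : Finset (Fin (n + 1))), N ((-1) ^ ((r : ℕ) + j) * A r j *
            (A.submatrix r.succAbove j.succAbove).det) :=
          Finset.le_sum_of_subadditive N (map_zero N).le (map_add_le_add N) _ _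
      _ ≤ ({j₁, j₂} : Finset (Fin (n + 1))).card • (n.factorial * ∏ i, c i) :=
          Finset.sum_le_card_nsmul _ _ _ fun j _ => hterm j
      _ ≤ (2 : ℕ) • (n.factorial * ∏ i, c i) := by
          gcongr
          exact Finset.card_le_two
      _ = _ := by rw [nsmul_eq_mul]; push_cast; ring
  · intro j _ hj
    simp only [Finset.mem_insert, Finset.mem_singleton, not_or] at hj
    simp [hr j hj.1 hj.2]

lemma nonarchimedean_det_le {R : Type*} [CommRing R] [Nontrivial R] {n : ℕ}
    (N : AbsoluteValue R ℝ) (hN : IsNonarchimedean N) (A : Matrix (Fin n) (Fin n) R)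
    (c : Fin n → ℝ) (hA : ∀ i j, N (A i j) ≤ c i) :
    N A.det ≤ ∏ i, c i := by
  rw [Matrix.det_apply, ← Finset.sum_coe_sort]
  obtain ⟨σ, -, hσ⟩ := hN.finset_image_add_of_nonempty (t := Finset.univ)
    (g := fun σ : Equiv.Perm (Fin n) => Equiv.Perm.sign σ • ∏ i, A (σ i) i) ⟨1, by simp⟩
  refine le_trans ?_ (hσ.trans ?_)
  · simp
  · have : N (Equiv.Perm.sign σ • ∏ i, A (σ i) i) = ∏ i, N (A (σ i) i) := by
      rcases Int.units_eq_one_or (Equiv.Perm.sign σ) with h | h <;>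
        simp [h, map_prod]
    rw [this, ← Equiv.prod_comp σ c]
    exact Finset.prod_le_prod (fun _ _ => N.nonneg _) fun i _ => hA _ _

/-! ### The length of a complex polynomial -/

/-- The sum of the absolute values of the coefficients, as a seminorm on the additive group. -/
noncomputable def lengthAdd : AddGroupSeminorm ℂ[X] where
  toFun p := p.sum fun _ a => ‖a‖
  map_zero' := by simp
  add_le' p q := by
    have h (r : ℂ[X]) (hr : r.support ⊆ p.support ∪ q.support) :
        (r.sum fun _ a => ‖a‖) = ∑ i ∈ p.support ∪ q.support, ‖r.coeff i‖ :=
      Polynomial.sum_eq_of_subset _ (by simp) hr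
    rw [h _ support_add, h p Finset.subset_union_left, h q Finset.subset_union_right,
      ← Finset.sum_add_distrib]
    exact Finset.sum_le_sum fun i _ => by simpa using norm_add_le _ _
  neg' p := by simp [Polynomial.sum_def]

lemma lengthAdd_monomial (i : ℕ) (a : ℂ) : lengthAdd (monomial i a) = ‖a‖ :=
  Polynomial.sum_monomial_index a _ (by simp)

/-- The length of a complex polynomial, i.e. the sum of the absolute values of its coefficients. -/
noncomputable def length : RingSeminorm ℂ[X] where
  __ := lengthAdd
  mul_le' p q := by
    change lengthAdd (p * q) ≤ (p.sum fun _ a => ‖a‖) * (q.sum fun _ a => ‖a‖)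
    rw [Polynomial.mul_eq_sum_sum, Polynomial.sum_def p, Finset.sum_mul]
    refine (Finset.le_sum_of_subadditive lengthAdd (map_zero lengthAdd).le
      (map_add_le_add _) _ _).trans (Finset.sum_le_sum fun i _ => ?_)
    rw [Polynomial.sum_def, Polynomial.sum_def, Finset.mul_sum]
    refine (Finset.le_sum_of_subadditive lengthAdd (map_zero lengthAdd).le
      (map_add_le_add _) _ _).trans (Finset.sum_le_sum fun j _ => ?_)
    rw [lengthAdd_monomial, norm_mul]

lemma length_one : length 1 = 1 :=
  (lengthAdd_monomial 0 1).trans norm_one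

lemma length_le_of_coeff_le {p : ℂ[X]} {n : ℕ} {B : ℝ} (hn : p.natDegree ≤ n)
    (hB : ∀ i, ‖p.coeff i‖ ≤ B) : length p ≤ (n + 1) * B := by
  change (p.sum fun _ a => ‖a‖) ≤ _
  rw [Polynomial.sum_over_range' p (by simp) (n + 1) (by lia)]
  simpa using Finset.sum_le_card_nsmul (Finset.range (n + 1)) (fun i => ‖p.coeff i‖) B
    fun i _ => hB i

lemma mahlerMeasure_pow (p : ℂ[X]) (n : ℕ) :
    (p ^ n).mahlerMeasure = p.mahlerMeasure ^ n := by
  induction n with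
  | zero => simp
  | succ n ih => rw [pow_succ, pow_succ, mahlerMeasure_mul, ih]

lemma norm_coeff_le_two_pow_mul_mahlerMeasure {p : ℂ[X]} {k : ℕ} (hk : p.natDegree ≤ k) (i : ℕ) :
    ‖p.coeff i‖ ≤ 2 ^ k * p.mahlerMeasure := by
  refine (norm_coeff_le_choose_mul_mahlerMeasure i p).trans ?_
  gcongr
  · exact p.mahlerMeasure_nonneg
  · exact_mod_cast (Nat.choose_le_two_pow _ _).trans (Nat.pow_le_pow_right (by simp) hk)

/-! ### The Sylvester matrix and elimination -/

section Elimination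

variable {R : Type*} [CommRing R]

/-- The value `∑ F_i A ^ i B ^ (d - i)` at `(A, B)` of `F`, homogenized as a form of degree `d`. -/
noncomputable def homEval (F : R[X]) (d : ℕ) (A B : R) : R :=
  ∑ i ∈ Finset.range (d + 1), F.coeff i * A ^ i * B ^ (d - i)

/-- The row `((A ^ j * B ^ (d - 1 - j) * g₀)_j, (A ^ j * B ^ (d - 1 - j) * g₁)_j)`. The block of
`g₀` comes first because the first `d` columns of `sylvester P Q d d` hold the coefficients of
`Q`. -/
noncomputable def elimRow (d : ℕ) (A B g₁ g₀ : R) : Fin (d + d) → R :=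
  Fin.addCases (fun j => A ^ (j : ℕ) * B ^ (d - 1 - j) * g₀)
    (fun j => A ^ (j : ℕ) * B ^ (d - 1 - j) * g₁)

/-- A column of the Sylvester matrix, paired with the monomials `A ^ i * B ^ (2 * d - 1 - i)`. -/
lemma sum_shift_eq (F : R[X]) (d : ℕ) (A B : R) (j : Fin d) :
    ∑ i : Fin (d + d), (A ^ (i : ℕ) * B ^ (2 * d - 1 - i)) *
      (if (i : ℕ) ∈ Set.Icc (j : ℕ) (j + d) then F.coeff (i - j) else 0) =
    A ^ (j : ℕ) * B ^ (d - 1 - j) * homEval F d A B := by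
  rw [Fin.sum_univ_eq_sum_range (fun i => (A ^ i * B ^ (2 * d - 1 - i)) *
      (if i ∈ Set.Icc (j : ℕ) (j + d) then F.coeff (i - j) else 0)) (d + d)]
  have hj := j.isLt
  rw [← Finset.sum_subset (s₁ := Finset.Ico (j : ℕ) (j + (d + 1)))]
  · rw [Finset.sum_Ico_eq_sum_range, homEval, Finset.mul_sum, Nat.add_sub_cancel_left]
    refine Finset.sum_congr rfl fun i hi => ?_
    have hi := Finset.mem_range.mp hi
    rw [if_pos (by simp; lia), Nat.add_sub_cancel_left, pow_add,
      show 2 * d - 1 - (j + i) = (d - 1 - j) + (d - i) by lia, pow_add]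
    ring
  · intro i hi
    simp only [Finset.mem_Ico, Finset.mem_range] at *
    lia
  · intro i _ hi
    rw [if_neg, mul_zero]
    simp only [Finset.mem_Ico, Set.mem_Icc] at *
    lia

lemma vecMul_sylvester (P Q : R[X]) (d : ℕ) (A B : R) :
    Matrix.vecMul (fun i : Fin (d + d) => A ^ (i : ℕ) * B ^ (2 * d - 1 - i)) (sylvester P Q d d) =
      elimRow d A B (homEval P d A B) (homEval Q d A B) := by
  ext j
  rw [Matrix.vecMul, dotProduct]
  induction j using Fin.addCases with
  | left j =>
    simp only [sylvester, Matrix.of_apply, Fin.addCases_left, elimRow]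
    exact sum_shift_eq Q d A B j
  | right j =>
    simp only [sylvester, Matrix.of_apply, Fin.addCases_right, elimRow]
    exact sum_shift_eq P d A B j

/-- Cramer's rule, in the form that replaces a row. -/
lemma det_mul_eq_det_updateRow {n : Type*} [Fintype n] [DecidableEq n] (M : Matrix n n R)
    (y : n → R) (i : n) : M.det * y i = (M.updateRow i (Matrix.vecMul y M)).det := by
  rw [← Matrix.cramer_transpose_apply, ← Matrix.mulVec_transpose, Matrix.cramer_eq_adjugate_mulVec,
    Matrix.mulVec_mulVec, Matrix.adjugate_mul, Matrix.det_transpose,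
    Matrix.smul_mulVec, Matrix.one_mulVec, Pi.smul_apply, smul_eq_mul]

/-- Elimination: if `(P(A, B), Q(A, B)) = G • (g₁, g₀)`, then for each monomial of degree
`2 * d - 1` in `A` and `B` its product with the resultant is `G` times a determinant that is linear in
`(g₁, g₀)`. -/
lemma resultant_mul_eq (P Q : R[X]) (d : ℕ) (A B G g₁ g₀ : R)
    (hP : homEval P d A B = G * g₁) (hQ : homEval Q d A B = G * g₀) (i : Fin (d + d)) :
    resultant P Q d d * (A ^ (i : ℕ) * B ^ (2 * d - 1 - i)) =
      G * ((sylvester P Q d d).updateRow i (elimRow d A B g₁ g₀)).det := by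
  have hrow : elimRow d A B (homEval P d A B) (homEval Q d A B) = G • elimRow d A B g₁ g₀ := by
    ext j
    induction j using Fin.addCases <;>
      simp only [elimRow, hP, hQ, Pi.smul_apply, smul_eq_mul, Fin.addCases_left,
        Fin.addCases_right] <;> ring
  rw [resultant, det_mul_eq_det_updateRow (sylvester P Q d d)
    (fun i : Fin (d + d) => A ^ (i : ℕ) * B ^ (2 * d - 1 - i)), vecMul_sylvester, hrow,
    Matrix.det_updateRow_smul]

end Elimination

/-! ### Local estimates -/

section Entries

variable {R : Type*} [CommRing R]

lemma sylvester_entry_zero {P Q : R[X]} {e : ℕ} {j : Fin ((e + 1) + (e + 1))}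
    (h₁ : j ≠ Fin.castAdd (e + 1) 0) (h₂ : j ≠ Fin.natAdd (e + 1) 0) :
    sylvester P Q (e + 1) (e + 1) (0 : Fin ((e + 1 + e) + 1)) j = 0 := by
  induction j using Fin.addCases with
  | left j =>
    have : (j : ℕ) ≠ 0 := fun h => h₁ (by ext; simpa using h)
    simp only [sylvester, Matrix.of_apply, Fin.addCases_left]
    rw [if_neg]
    simp [this]
  | right j =>
    have : (j : ℕ) ≠ 0 := fun h => h₂ (by ext; simpa using h)
    simp only [sylvester, Matrix.of_apply, Fin.addCases_right]
    rw [if_neg]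
    simp [this]

lemma sylvester_entry_last {P Q : R[X]} {e : ℕ} {j : Fin ((e + 1) + (e + 1))}
    (h₁ : j ≠ Fin.castAdd (e + 1) (Fin.last e)) (h₂ : j ≠ Fin.natAdd (e + 1) (Fin.last e)) :
    sylvester P Q (e + 1) (e + 1) (Fin.last (e + 1 + e)) j = 0 := by
  induction j using Fin.addCases with
  | left j =>
    have : (j : ℕ) ≠ e := fun h => h₁ (by ext; simpa using h)
    simp only [sylvester, Matrix.of_apply, Fin.addCases_left]
    rw [if_neg]
    simp
    lia
  | right j =>
    have : (j : ℕ) ≠ e := fun h => h₂ (by ext; simp; lia)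
    simp only [sylvester, Matrix.of_apply, Fin.addCases_right]
    rw [if_neg]
    simp
    lia

lemma le_pow_of_submultiplicative {N : R → ℝ} (hnn : ∀ x, 0 ≤ N x) (h1 : N 1 ≤ 1)
    (hmul : ∀ x y, N (x * y) ≤ N x * N y) {x : R} {c : ℝ} (hx : N x ≤ c) (n : ℕ) :
    N (x ^ n) ≤ c ^ n := by
  induction n with
  | zero => simpa using h1
  | succ n ih =>
    rw [pow_succ, pow_succ]
    exact (hmul _ _).trans (mul_le_mul ih hx (hnn _) ((hnn _).trans ih))

lemma elim_entry_le {N : R → ℝ} (h0 : N 0 = 0) (hnn : ∀ x, 0 ≤ N x) (h1 : N 1 ≤ 1)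
    (hmul : ∀ x y, N (x * y) ≤ N x * N y) {P Q : R[X]} {A B g₁ g₀ : R} {ρ φ γ : ℝ}
    (hP : ∀ j, N (P.coeff j) ≤ ρ) (hQ : ∀ j, N (Q.coeff j) ≤ ρ) (hA : N A ≤ φ) (hB : N B ≤ φ)
    (hg₁ : N g₁ ≤ γ) (hg₀ : N g₀ ≤ γ) (d : ℕ) (i a b : Fin (d + d)) :
    N ((sylvester P Q d d).updateRow i (elimRow d A B g₁ g₀) a b) ≤
      Function.update (fun _ => ρ) i (φ ^ (d - 1) * γ) a := by
  have hφ : 0 ≤ φ := (hnn _).trans hA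
  have hρ : 0 ≤ ρ := (hnn _).trans (hP 0)
  have hform (j : Fin d) {g : R} (hg : N g ≤ γ) :
      N (A ^ (j : ℕ) * B ^ (d - 1 - j) * g) ≤ φ ^ (d - 1) * γ := by
    have hj : d - 1 = j + (d - 1 - j) := by lia
    refine (hmul _ _).trans (mul_le_mul ?_ hg (hnn _) (by positivity))
    refine (hmul _ _).trans ?_
    conv_rhs => rw [hj, pow_add]
    exact mul_le_mul (le_pow_of_submultiplicative hnn h1 hmul hA _)
      (le_pow_of_submultiplicative hnn h1 hmul hB _) (hnn _) (by positivity)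
  by_cases hai : a = i
  · subst hai
    rw [Matrix.updateRow_self, Function.update_self]
    induction b using Fin.addCases with
    | left j => simpa only [elimRow, Fin.addCases_left] using hform j hg₀
    | right j => simpa only [elimRow, Fin.addCases_right] using hform j hg₁
  · rw [Matrix.updateRow_ne hai, Function.update_of_ne hai]
    induction b using Fin.addCases with
    | left j =>
      simp only [sylvester, Matrix.of_apply, Fin.addCases_left]
      split_ifs
      exacts [hQ _, h0.trans_le hρ]
    | right j =>
      simp only [sylvester, Matrix.of_apply, Fin.addCases_right]
      split_ifs
      exacts [hP _, h0.trans_le hρ]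

lemma prod_update_const {e : ℕ} (i : Fin ((e + 1) + (e + 1))) (ρ c : ℝ) :
    ∏ a, Function.update (fun _ => ρ) i c a = ρ ^ (2 * e + 1) * c := by
  rw [Finset.prod_update_of_mem (Finset.mem_univ i), Finset.prod_const,
    Finset.sdiff_singleton_eq_erase,
    Finset.card_erase_of_mem (Finset.mem_univ i), Finset.card_univ, Fintype.card_fin,
    show e + 1 + (e + 1) - 1 = 2 * e + 1 by lia, mul_comm]

end Entries

/-- The constant in the estimate at an archimedean place, for `deg_w R = e + 1`, coefficients of
`R` of degree at most `m`, `deg f ≤ k`, and `R(z, f(z))` of degree at most `n`. The factor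
`2 * (2 * e + 1)!` counts the terms of the determinant, the powers of `m + 1`, `k + 1`, `n + 1`
compare lengths with maxima of coefficients, and `2 ^ (k * (2 * e + 1))` compares the Mahler measures of
the numerator and denominator of `f` with the maxima of their coefficients. -/
noncomputable def archConst (e m k n : ℕ) : ℝ :=
  2 * (2 * e + 1).factorial * (m + 1) ^ (2 * e + 1) * (k + 1) ^ e * (n + 1) * 2 ^ (k * (2 * e + 1))

/-- The estimate at an archimedean place: the Mahler measure of `S * A ^ (2 * e + 1)` is
multiplicative, and it is at most the length of the determinant that equals this product. -/
lemma archimedean_estimate {e m k n : ℕ} {P Q : ℂ[X][X]} {A B g₁ g₀ S : ℂ[X]}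
    (hS : ∀ i : Fin ((e + 1) + (e + 1)), S * (A ^ (i : ℕ) * B ^ (2 * (e + 1) - 1 - i)) =
      ((sylvester P Q (e + 1) (e + 1)).updateRow i (elimRow (e + 1) A B g₁ g₀)).det)
    (hPm : ∀ j, (P.coeff j).natDegree ≤ m) (hQm : ∀ j, (Q.coeff j).natDegree ≤ m)
    (hAk : A.natDegree ≤ k) (hBk : B.natDegree ≤ k) (hg₁n : g₁.natDegree ≤ n)
    (hg₀n : g₀.natDegree ≤ n) {ρ φ γ : ℝ}
    (hP : ∀ i j, ‖(P.coeff j).coeff i‖ ≤ ρ) (hQ : ∀ i j, ‖(Q.coeff j).coeff i‖ ≤ ρ)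
    (hA : ∀ i, ‖A.coeff i‖ ≤ φ) (hB : ∀ i, ‖B.coeff i‖ ≤ φ)
    (hg₁ : ∀ i, ‖g₁.coeff i‖ ≤ γ) (hg₀ : ∀ i, ‖g₀.coeff i‖ ≤ γ)
    (hφ : 0 < φ) (hmax : (∃ i, ‖A.coeff i‖ = φ) ∨ ∃ i, ‖B.coeff i‖ = φ) :
    ‖S.leadingCoeff‖ * φ ^ (e + 1) ≤ archConst e m k n * (ρ ^ (2 * e + 1) * γ) := by
  set ρ' := (m + 1) * ρ with hρ'
  set φ' := (k + 1) * φ with hφ'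
  set γ' := (n + 1) * γ with hγ'
  have hentry := elim_entry_le (N := length) (map_zero _) (apply_nonneg _) length_one.le
    (map_mul_le_mul _) (P := P) (Q := Q) (A := A) (B := B) (g₁ := g₁) (g₀ := g₀)
    (fun j => length_le_of_coeff_le (hPm j) (hP · j))
    (fun j => length_le_of_coeff_le (hQm j) (hQ · j))
    (length_le_of_coeff_le hAk hA) (length_le_of_coeff_le hBk hB)
    (length_le_of_coeff_le hg₁n hg₁) (length_le_of_coeff_le hg₀n hg₀) (e + 1)
  have hdet (i r : Fin ((e + 1 + e) + 1)) (hir : r ≠ i) (j₁ j₂ : Fin ((e + 1) + (e + 1)))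
      (hr : ∀ j, j ≠ j₁ → j ≠ j₂ → sylvester P Q (e + 1) (e + 1) r j = 0) :
      (S * (A ^ (i : ℕ) * B ^ (2 * (e + 1) - 1 - i))).mahlerMeasure ≤
        2 * (2 * e + 1).factorial * (ρ' ^ (2 * e + 1) * (φ' ^ e * γ')) := by
    rw [hS i]
    refine (mahlerMeasure_le_sum_norm_coeff _).trans ?_
    have := seminorm_det_le_of_sparse_row (n := e + 1 + e) length length_one.le
      ((sylvester P Q (e + 1) (e + 1)).updateRow i (elimRow (e + 1) A B g₁ g₀)) _ (hentry i)
      r j₁ j₂ (fun j h₁ h₂ => by rw [Matrix.updateRow_ne hir]; exact hr j h₁ h₂)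
    rw [show (e + 1 + e).factorial = (2 * e + 1).factorial by congr 1; lia] at this
    exact this.trans_eq (congrArg _ (prod_update_const (e := e) i _ _))
  have hfin {F : ℂ[X]} (hFk : F.natDegree ≤ k) (hF : ∃ i, ‖F.coeff i‖ = φ)
      (hM : (S * F ^ (2 * e + 1)).mahlerMeasure ≤
        2 * (2 * e + 1).factorial * (ρ' ^ (2 * e + 1) * (φ' ^ e * γ'))) :
      ‖S.leadingCoeff‖ * φ ^ (e + 1) ≤ archConst e m k n * (ρ ^ (2 * e + 1) * γ) := by
    obtain ⟨i, hi⟩ := hF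
    have h1 : φ ≤ 2 ^ k * F.mahlerMeasure := hi ▸ norm_coeff_le_two_pow_mul_mahlerMeasure hFk i
    have h2 : ‖S.leadingCoeff‖ * φ ^ (2 * e + 1) ≤ 2 ^ (k * (2 * e + 1)) *
        (2 * (2 * e + 1).factorial * (ρ' ^ (2 * e + 1) * (φ' ^ e * γ'))) := by
      calc ‖S.leadingCoeff‖ * φ ^ (2 * e + 1)
          ≤ S.mahlerMeasure * (2 ^ k * F.mahlerMeasure) ^ (2 * e + 1) := by
            gcongr
            · exact S.mahlerMeasure_nonneg
            · exact leadingCoeff_le_mahlerMeasure S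
        _ = 2 ^ (k * (2 * e + 1)) * (S * F ^ (2 * e + 1)).mahlerMeasure := by
            rw [mahlerMeasure_mul, mahlerMeasure_pow, mul_pow, pow_mul]; ring
        _ ≤ _ := by gcongr
    refine le_of_mul_le_mul_right ?_ (pow_pos hφ e)
    calc ‖S.leadingCoeff‖ * φ ^ (e + 1) * φ ^ e = ‖S.leadingCoeff‖ * φ ^ (2 * e + 1) := by ring
      _ ≤ _ := h2
      _ = _ := by
        rw [archConst, hρ', hφ', hγ', mul_pow, mul_pow]; ring
  -- When the last row is replaced, row `0` stays sparse, and vice versa.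
  rcases hmax with h | h
  · refine hfin hAk h ?_
    have := hdet (Fin.last _) 0 (by simp [Fin.ext_iff]; lia) (Fin.castAdd (e + 1) 0)
      (Fin.natAdd (e + 1) 0) (fun j h₁ h₂ => sylvester_entry_zero h₁ h₂)
    rwa [Fin.val_last, show e + 1 + e = 2 * e + 1 by lia,
      show 2 * (e + 1) - 1 - (2 * e + 1) = 0 by lia, pow_zero, mul_one] at this
  · refine hfin hBk h ?_
    have := hdet 0 (Fin.last _) (by simp [Fin.ext_iff]) (Fin.castAdd (e + 1) (Fin.last e))
      (Fin.natAdd (e + 1) (Fin.last e)) (fun j h₁ h₂ => sylvester_entry_last h₁ h₂)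
    rwa [Fin.val_zero, pow_zero, one_mul, show 2 * (e + 1) - 1 - 0 = 2 * e + 1 by lia] at this

/-- The estimate at a nonarchimedean place. The Gauss norm takes the place of both the Mahler
measure and the length, so there is no constant. -/
lemma nonarchimedean_estimate {K : Type*} [Field K] (v : AbsoluteValue K ℝ)
    (hv : IsNonarchimedean v) {e : ℕ} {P Q : K[X][X]} {A B g₁ g₀ S : K[X]}
    (hS : ∀ i : Fin ((e + 1) + (e + 1)), S * (A ^ (i : ℕ) * B ^ (2 * (e + 1) - 1 - i)) =
      ((sylvester P Q (e + 1) (e + 1)).updateRow i (elimRow (e + 1) A B g₁ g₀)).det)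
    {ρ φ γ : ℝ}
    (hP : ∀ i j, v ((P.coeff j).coeff i) ≤ ρ) (hQ : ∀ i j, v ((Q.coeff j).coeff i) ≤ ρ)
    (hA : ∀ i, v (A.coeff i) ≤ φ) (hB : ∀ i, v (B.coeff i) ≤ φ)
    (hg₁ : ∀ i, v (g₁.coeff i) ≤ γ) (hg₀ : ∀ i, v (g₀.coeff i) ≤ γ)
    (hφ : 0 < φ) (hmax : (∃ i, v (A.coeff i) = φ) ∨ ∃ i, v (B.coeff i) = φ) :
    v S.leadingCoeff * φ ^ (e + 1) ≤ ρ ^ (2 * e + 1) * γ := by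
  have := gaussNorm_isAbsoluteValue (v := v) hv one_pos
  let N : AbsoluteValue K[X] ℝ := IsAbsoluteValue.toAbsoluteValue (gaussNorm v 1)
  have hN : IsNonarchimedean N := isNonarchimedean_gaussNorm v hv zero_le_one
  have hcoeff (F : K[X]) (i : ℕ) : v (F.coeff i) ≤ N F := by
    change _ ≤ gaussNorm v 1 F
    simpa using F.le_gaussNorm v zero_le_one i
  have hle {F : K[X]} {c : ℝ} (h : ∀ i, v (F.coeff i) ≤ c) : N F ≤ c := by
    obtain ⟨i, hi⟩ := F.exists_eq_gaussNorm v 1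
    exact hi.trans_le (by simpa using h i)
  have hdet (i : Fin ((e + 1 + e) + 1)) :
      N (S * (A ^ (i : ℕ) * B ^ (2 * (e + 1) - 1 - i))) ≤ ρ ^ (2 * e + 1) * (φ ^ e * γ) := by
    rw [hS i]
    have := nonarchimedean_det_le (n := e + 1 + e + 1) N hN _ _ (elim_entry_le (N := N)
      (map_zero _) (apply_nonneg _) (map_one _).le (fun _ _ => (map_mul _ _ _).le)
      (fun j => hle (hP · j)) (fun j => hle (hQ · j)) (hle hA) (hle hB) (hle hg₁) (hle hg₀)
      (e + 1) i)
    exact this.trans_eq (prod_update_const (e := e) i _ _)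
  have hfin {F : K[X]} (hF : ∃ i, v (F.coeff i) = φ)
      (hM : N (S * F ^ (2 * e + 1)) ≤ ρ ^ (2 * e + 1) * (φ ^ e * γ)) :
      v S.leadingCoeff * φ ^ (e + 1) ≤ ρ ^ (2 * e + 1) * γ := by
    obtain ⟨i, hi⟩ := hF
    have h1 : φ ≤ N F := hi ▸ hcoeff F i
    refine le_of_mul_le_mul_right ?_ (pow_pos hφ e)
    calc v S.leadingCoeff * φ ^ (e + 1) * φ ^ e = v S.leadingCoeff * φ ^ (2 * e + 1) := by ring
      _ ≤ N S * N F ^ (2 * e + 1) := by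
          gcongr
          exact hcoeff S _
      _ = N (S * F ^ (2 * e + 1)) := by rw [map_mul, map_pow]
      _ ≤ _ := hM
      _ = _ := by ring
  rcases hmax with h | h
  · refine hfin h ?_
    have := hdet (Fin.last _)
    rwa [Fin.val_last, show e + 1 + e = 2 * e + 1 by lia,
      show 2 * (e + 1) - 1 - (2 * e + 1) = 0 by lia, pow_zero, mul_one] at this
  · refine hfin h ?_
    have := hdet 0
    rwa [Fin.val_zero, pow_zero, one_mul, show 2 * (e + 1) - 1 - 0 = 2 * e + 1 by lia] at this

/-! ### Heights under extension of the number field -/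

section Extension

open NumberField InfinitePlace

variable {K L : Type*} [Field K] [NumberField K] [Field L] [NumberField L] [Algebra K L]

lemma prod_infinitePlace_pow_mult (f : InfinitePlace K → ℝ) :
    ∏ w : InfinitePlace K, f w ^ w.mult = ∏ φ : K →+* ℂ, f (InfinitePlace.mk φ) := by
  classical
  rw [← Finset.prod_fiberwise Finset.univ InfinitePlace.mk]
  refine Finset.prod_congr rfl fun w _ => ?_
  rw [Finset.prod_congr rfl (g := fun _ => f w) fun φ hφ => by rw [(Finset.mem_filter.mp hφ).2],
    Finset.prod_const, card_filter_mk_eq]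

open Classical in
/-- Every complex embedding of `K` has `[L : K]` extensions to `L`. -/
lemma card_extensions (ψ : K →+* ℂ) :
    (Finset.univ.filter fun φ : L →+* ℂ => φ.comp (algebraMap K L) = ψ).card =
      Module.finrank K L := by
  let _ := ψ.toAlgebra
  rw [← AlgHom.card K L ℂ, ← Fintype.card_subtype]
  refine Fintype.card_congr ⟨fun φ => ⟨φ.1, fun r => RingHom.congr_fun φ.2 r⟩,
    fun φ => ⟨φ, by ext r; exact φ.commutes r⟩, fun _ => rfl, fun _ => rfl⟩

lemma prod_embeddings_extension (f : (K →+* ℂ) → ℝ) :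
    ∏ φ : L →+* ℂ, f (φ.comp (algebraMap K L)) = (∏ ψ, f ψ) ^ Module.finrank K L := by
  classical
  rw [← Finset.prod_fiberwise Finset.univ (fun φ : L →+* ℂ => φ.comp (algebraMap K L)),
    ← Finset.prod_pow]
  refine Finset.prod_congr rfl fun ψ _ => ?_
  rw [Finset.prod_congr rfl (g := fun _ => f ψ) fun φ hφ => by rw [(Finset.mem_filter.mp hφ).2],
    Finset.prod_const, card_extensions]

/-- The behaviour of heights under an extension of number fields. For an integral tuple, the finite
part of the height is the inverse of the absolute norm of the ideal generated by the entries, and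
the infinite part is a product over the complex embeddings. -/
lemma mulHeight_extension {ι : Type*} [Finite ι] (x : ι → K) :
    Height.mulHeight (fun i => algebraMap K L (x i)) =
      Height.mulHeight x ^ Module.finrank K L := by
  by_cases hx : x = 0
  · subst hx
    simp
  -- Clearing denominators, the tuple may be assumed integral.
  obtain ⟨b, hb⟩ := IsLocalization.exist_integer_multiples_of_finite (nonZeroDivisors (𝓞 K)) x
  choose y hy using hb
  set c : K := algebraMap (𝓞 K) K b with hc
  have hc0 : c ≠ 0 := by
    rw [hc]; simp
  have hcx : c • x = fun i => (y i : K) := by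
    ext i
    rw [Pi.smul_apply, smul_eq_mul]
    exact ((hy i).trans (Algebra.smul_def _ _)).symm
  have hy0 : y ≠ 0 := by
    rintro rfl
    apply hx
    have : c • x = 0 := hcx.trans (by ext; simp)
    simpa [hc0] using this
  let yL : ι → 𝓞 L := fun i => algebraMap (𝓞 K) (𝓞 L) (y i)
  have hyL (i) : (yL i : L) = algebraMap K L (y i) := rfl
  have hyL0 : yL ≠ 0 := by
    obtain ⟨i, hi⟩ := Function.ne_iff.mp hy0
    refine Function.ne_iff.mpr ⟨i, ?_⟩
    simpa [yL] using hi
  have hcL : algebraMap K L c ≠ 0 := by simpa using hc0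
  rw [← Height.mulHeight_smul_eq_mulHeight x hc0,
    ← Height.mulHeight_smul_eq_mulHeight (fun i => algebraMap K L (x i)) hcL, hcx]
  have : (algebraMap K L c • fun i => algebraMap K L (x i)) = fun i => (yL i : L) := by
    ext i
    rw [hyL, ← congrFun hcx i]
    simp
  rw [this]
  have hyK0 : (fun i => (y i : K)) ≠ 0 := by
    obtain ⟨i, hi⟩ := Function.ne_iff.mp hy0
    exact Function.ne_iff.mpr ⟨i, by simpa using hi⟩
  have hyL0' : (fun i => (yL i : L)) ≠ 0 := by
    obtain ⟨i, hi⟩ := Function.ne_iff.mp hyL0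
    exact Function.ne_iff.mpr ⟨i, by simpa using hi⟩
  rw [NumberField.mulHeight_eq hyK0, NumberField.mulHeight_eq hyL0', mul_pow]
  congr 1
  · rw [prod_infinitePlace_pow_mult (fun w => ⨆ i, w (yL i : L)),
      prod_infinitePlace_pow_mult (fun w => ⨆ i, w (y i : K)), ← prod_embeddings_extension]
    rfl
  · have h1 := absNorm_mul_finprod_finitePlace_eq_one hyL0
    have h2 := absNorm_mul_finprod_finitePlace_eq_one hy0
    have hmap : Ideal.span (Set.range yL) =
        (Ideal.span (Set.range y)).map (algebraMap (𝓞 K) (𝓞 L)) := by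
      rw [Ideal.map_span, ← Set.range_comp]
      rfl
    have hrank : Module.finrank (𝓞 K) (𝓞 L) = Module.finrank K L := by
      exact (IsFractionRing.finrank_eq (𝓞 K) K (𝓞 L) L).symm
    rw [hmap, Ideal.absNorm_algebraMap, hrank] at h1
    rw [eq_inv_of_mul_eq_one_right h1, eq_inv_of_mul_eq_one_right h2]
    simp

lemma logHeight_extension_div_finrank {ι : Type*} [Finite ι] (x : ι → K) :
    Height.logHeight (fun i => algebraMap K L (x i)) / Module.finrank ℚ L =
      Height.logHeight x / Module.finrank ℚ K := by
  have hKL : (Module.finrank K L : ℝ) ≠ 0 := by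
    exact_mod_cast (Module.finrank_pos (R := K) (M := L)).ne'
  rw [Height.logHeight_eq_log_mulHeight, mulHeight_extension, Real.log_pow,
    ← Height.logHeight_eq_log_mulHeight, ← Module.finrank_mul_finrank ℚ K L, Nat.cast_mul,
    mul_comm (Module.finrank ℚ K : ℝ), mul_div_mul_left _ _ hKL]

end Extension

/-- The absolute height can be computed in any number field that contains the coordinates. -/
lemma absLogHeight_eq {ι : Type} [Finite ι] (L : IntermediateField ℚ Qbar) [NumberField L]
    (x : ι → L) :
    absLogHeight (fun i => (x i : Qbar)) = Height.logHeight x / Module.finrank ℚ L := by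
  have hle : coordField (fun i => (x i : Qbar)) ≤ L := by
    rw [IntermediateField.adjoin_le_iff]
    rintro _ ⟨i, rfl⟩
    exact (x i).2
  let _ : Algebra (coordField fun i => (x i : Qbar)) L :=
    (IntermediateField.inclusion hle).toRingHom.toAlgebra
  exact (logHeight_extension_div_finrank (L := L) fun i => (⟨(x i : Qbar),
    IntermediateField.subset_adjoin ℚ _ ⟨i, rfl⟩⟩ : coordField fun i => (x i : Qbar))).symm

/-! ### From local estimates to heights -/

section Global

open Height Height.AdmissibleAbsValues Function

variable {K : Type*} [Field K] [AdmissibleAbsValues K]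

lemma hasFiniteMulSupport_iSup {ι : Type*} [Finite ι] {x : ι → K} (hx : x ≠ 0) :
    (fun v : nonarchAbsVal (K := K) => ⨆ i, v.val (x i)).HasFiniteMulSupport := by
  obtain ⟨i₀, hi₀⟩ := ne_iff.mp hx
  have : Nonempty {j // x j ≠ 0} := ⟨⟨i₀, hi₀⟩⟩
  have h : (fun v : nonarchAbsVal (K := K) => ⨆ i, v.val (x i)) =
      fun v => ⨆ i : {j // x j ≠ 0}, v.val (x i) := by
    ext v
    exact Finite.iSup_eq_iSup_subtype hx
  rw [h]
  exact HasFiniteMulSupport.iSup fun i => hasFiniteMulSupport i.2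

/-- Local inequalities at all places, with a scalar `c` that disappears by the product formula,
multiply to an inequality between heights. -/
lemma mulHeight_pow_le {ι₁ ι₂ ι₃ : Type*} [Finite ι₁] [Finite ι₂] [Finite ι₃] {x : ι₁ → K}
    {y : ι₂ → K} {z : ι₃ → K} (hx : x ≠ 0) (hy : y ≠ 0) (hz : z ≠ 0) {c : K} (hc : c ≠ 0)
    {d e : ℕ} {C : ℝ}
    (harch : ∀ v ∈ archAbsVal (K := K),
      v c * (⨆ i, v (x i)) ^ d ≤ C * ((⨆ i, v (y i)) ^ e * ⨆ i, v (z i)))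
    (hnonarch : ∀ v ∈ nonarchAbsVal (K := K),
      v c * (⨆ i, v (x i)) ^ d ≤ (⨆ i, v (y i)) ^ e * ⨆ i, v (z i)) :
    mulHeight x ^ d ≤ C ^ totalWeight K * (mulHeight y ^ e * mulHeight z) := by
  have hsup (v : AbsoluteValue K ℝ) : 0 ≤ ⨆ i, v (x i) :=
    Real.iSup_nonneg_of_nonnegHomClass v _
  have hfx := hasFiniteMulSupport_iSup hx
  have hfy := hasFiniteMulSupport_iSup hy
  have hfz := hasFiniteMulSupport_iSup hz
  have hfxd : (fun v : nonarchAbsVal (K := K) => (⨆ i, v.val (x i)) ^ d).HasFiniteMulSupport :=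
    hfx.pow d
  have hfye : (fun v : nonarchAbsVal (K := K) => (⨆ i, v.val (y i)) ^ e).HasFiniteMulSupport :=
    hfy.pow e
  have hfc := hasFiniteMulSupport hc
  have hL : mulHeight x ^ d = (archAbsVal.map fun v => v c * (⨆ i, v (x i)) ^ d).prod *
      ∏ᶠ v : nonarchAbsVal (K := K), v.val c * (⨆ i, v.val (x i)) ^ d := by
    rw [Multiset.prod_map_mul, Multiset.prod_map_pow, finprod_mul_distrib hfc hfxd,
      ← finprod_pow hfx, mul_mul_mul_comm, product_formula hc, one_mul, mulHeight_eq hx, mul_pow]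
  have hR : C ^ totalWeight K * (mulHeight y ^ e * mulHeight z) =
      (archAbsVal.map fun v => C * ((⨆ i, v (y i)) ^ e * ⨆ i, v (z i))).prod *
      ∏ᶠ v : nonarchAbsVal (K := K), (⨆ i, v.val (y i)) ^ e * ⨆ i, v.val (z i) := by
    rw [Multiset.prod_map_mul, Multiset.prod_map_mul, Multiset.prod_map_pow,
      finprod_mul_distrib hfye hfz, ← finprod_pow hfy, Multiset.map_const',
      Multiset.prod_replicate, mulHeight_eq hy, mulHeight_eq hz, totalWeight]
    ring
  rw [hL, hR]
  refine mul_le_mul ?_ ?_ ?_ ?_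
  · exact Multiset.prod_map_le_prod_map₀ _ _
      (fun v _ => mul_nonneg (v.nonneg _) (pow_nonneg (hsup v) _)) harch
  · exact finprod_le_finprod (hfc.mul hfxd)
      (fun v => mul_nonneg (v.val.nonneg _) (pow_nonneg (hsup v.val) _))
      (hfye.mul hfz) fun v => hnonarch v.1 v.2
  · exact finprod_nonneg fun v => mul_nonneg (v.val.nonneg _) (pow_nonneg (hsup v.val) _)
  · exact Multiset.prod_map_nonneg fun v hv =>
      (mul_nonneg (v.nonneg _) (pow_nonneg (hsup v) _)).trans (harch v hv)

end Global

lemma map_det_updateRow_elimRow {K K' : Type*} [CommRing K] [CommRing K'] (φ : K →+* K')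
    (P Q : K[X][X]) (A B g₁ g₀ : K[X]) (d : ℕ) (i : Fin (d + d)) :
    ((sylvester P Q d d).updateRow i (elimRow d A B g₁ g₀)).det.map φ =
      ((sylvester (P.map (mapRingHom φ)) (Q.map (mapRingHom φ)) d d).updateRow i
        (elimRow d (A.map φ) (B.map φ) (g₁.map φ) (g₀.map φ))).det := by
  rw [← coe_mapRingHom, RingHom.map_det, RingHom.mapMatrix_apply, Matrix.map_updateRow,
    ← RingHom.mapMatrix_apply, ← sylvester_map_map]
  congr 2
  ext1 j
  induction j using Fin.addCases <;> simp [elimRow, -Fin.natAdd_eq_addNat]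

lemma apply_le_iSup_of_mem {K : Type*} [Field K] {ι : Type*} [Finite ι] (v : AbsoluteValue K ℝ)
    {u : ι → K} {a : K} (ha : a ∈ insert 0 (Set.range u)) : v a ≤ ⨆ i, v (u i) := by
  rcases ha with rfl | ⟨i, rfl⟩
  · simpa using Real.iSup_nonneg_of_nonnegHomClass v u
  · exact Finite.le_ciSup (fun i => v (u i)) i

/-- The height inequality over a number field. The tuples `x`, `y`, `z` list the coefficients of
`A, B`, of `P, Q` and of `g₁, g₀`; zero coefficients may be left out or repeated. -/
lemma mulHeight_elim_le {K : Type*} [Field K] [NumberField K] {ι₁ ι₂ ι₃ : Type*} [Finite ι₁]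
    [Finite ι₂] [Finite ι₃] {e m k n : ℕ} {P Q : K[X][X]} {A B g₁ g₀ S : K[X]} (hS0 : S ≠ 0)
    (hS : ∀ i : Fin ((e + 1) + (e + 1)), S * (A ^ (i : ℕ) * B ^ (2 * (e + 1) - 1 - i)) =
      ((sylvester P Q (e + 1) (e + 1)).updateRow i (elimRow (e + 1) A B g₁ g₀)).det)
    (hPm : ∀ j, (P.coeff j).natDegree ≤ m) (hQm : ∀ j, (Q.coeff j).natDegree ≤ m)
    (hAk : A.natDegree ≤ k) (hBk : B.natDegree ≤ k) (hg₁n : g₁.natDegree ≤ n)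
    (hg₀n : g₀.natDegree ≤ n) {x : ι₁ → K} {y : ι₂ → K} {z : ι₃ → K}
    (hx0 : x ≠ 0) (hy0 : y ≠ 0) (hz0 : z ≠ 0)
    (hP : ∀ i j, (P.coeff j).coeff i ∈ insert 0 (Set.range y))
    (hQ : ∀ i j, (Q.coeff j).coeff i ∈ insert 0 (Set.range y))
    (hA : ∀ i, A.coeff i ∈ insert 0 (Set.range x))
    (hB : ∀ i, B.coeff i ∈ insert 0 (Set.range x))
    (hg₁ : ∀ i, g₁.coeff i ∈ insert 0 (Set.range z))
    (hg₀ : ∀ i, g₀.coeff i ∈ insert 0 (Set.range z))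
    (hx : ∀ t, (∃ i, A.coeff i = x t) ∨ ∃ i, B.coeff i = x t) :
    Height.mulHeight x ^ (e + 1) ≤ archConst e m k n ^ Height.totalWeight K *
      (Height.mulHeight y ^ (2 * e + 1) * Height.mulHeight z) := by
  obtain ⟨t₀, ht₀⟩ := Function.ne_iff.mp hx0
  have : Nonempty ι₁ := ⟨t₀⟩
  have hpos (v : AbsoluteValue K ℝ) : 0 < ⨆ i, v (x i) :=
    (v.pos ht₀).trans_le (Finite.le_ciSup (fun i => v (x i)) t₀)
  have hmax (v : AbsoluteValue K ℝ) :
      (∃ i, v (A.coeff i) = ⨆ i, v (x i)) ∨ ∃ i, v (B.coeff i) = ⨆ i, v (x i) := by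
    obtain ⟨t, ht⟩ := exists_eq_ciSup_of_finite (f := fun i => v (x i))
    rw [← ht]
    exact (hx t).imp (fun ⟨i, hi⟩ => ⟨i, by rw [hi]⟩) fun ⟨i, hi⟩ => ⟨i, by rw [hi]⟩
  refine mulHeight_pow_le hx0 hy0 hz0 (leadingCoeff_ne_zero.mpr hS0) (fun v hv => ?_)
    fun v hv => ?_
  · obtain ⟨φ, rfl⟩ : ∃ φ : K →+* ℂ, NumberField.place φ = v :=
      NumberField.mem_multisetInfinitePlace.mp hv
    have hnorm (a : K) : NumberField.place φ a = ‖φ a‖ := NumberField.place_apply φ a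
    have hmap (i : Fin ((e + 1) + (e + 1))) := (congrArg (Polynomial.map φ) (hS i)).trans
      (map_det_updateRow_elimRow φ P Q A B g₁ g₀ (e + 1) i)
    simp only [Polynomial.map_mul, Polynomial.map_pow] at hmap
    have := archimedean_estimate (e := e) (m := m) (k := k) (n := n) hmap
      (ρ := ⨆ i, NumberField.place φ (y i)) (φ := ⨆ i, NumberField.place φ (x i))
      (γ := ⨆ i, NumberField.place φ (z i))
      (fun j => by simpa using hPm j)
      (fun j => by simpa using hQm j)
      (natDegree_map_le.trans hAk) (natDegree_map_le.trans hBk)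
      (natDegree_map_le.trans hg₁n) (natDegree_map_le.trans hg₀n)
      (fun i j => by simpa [hnorm] using apply_le_iSup_of_mem (NumberField.place φ) (hP i j))
      (fun i j => by simpa [hnorm] using apply_le_iSup_of_mem (NumberField.place φ) (hQ i j))
      (fun i => by simpa [hnorm] using apply_le_iSup_of_mem (NumberField.place φ) (hA i))
      (fun i => by simpa [hnorm] using apply_le_iSup_of_mem (NumberField.place φ) (hB i))
      (fun i => by simpa [hnorm] using apply_le_iSup_of_mem (NumberField.place φ) (hg₁ i))
      (fun i => by simpa [hnorm] using apply_le_iSup_of_mem (NumberField.place φ) (hg₀ i))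
      (hpos _) (by simpa [hnorm] using hmax (NumberField.place φ))
    rwa [leadingCoeff_map, ← hnorm] at this
  · exact nonarchimedean_estimate v (Height.AdmissibleAbsValues.isNonarchimedean v hv) hS
      (fun i j => apply_le_iSup_of_mem v (hP i j)) (fun i j => apply_le_iSup_of_mem v (hQ i j))
      (fun i => apply_le_iSup_of_mem v (hA i)) (fun i => apply_le_iSup_of_mem v (hB i))
      (fun i => apply_le_iSup_of_mem v (hg₁ i)) (fun i => apply_le_iSup_of_mem v (hg₀ i))
      (hpos v) (hmax v)

/-! ### Nonvanishing of the resultant -/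

/-- Gauss's lemma: polynomials without common factor over `D` are coprime over its field of
fractions. -/
lemma isCoprime_map_of_isRelPrime {D K : Type*} [CommRing D] [IsDomain D] [NormalizedGCDMonoid D]
    [Field K] [Algebra D K] [IsFractionRing D K] {P Q : D[X]} (h : IsRelPrime P Q) (hQ : Q ≠ 0) :
    IsCoprime (P.map (algebraMap D K)) (Q.map (algebraMap D K)) := by
  have hinj : Function.Injective (algebraMap D K) := IsFractionRing.injective D K
  refine isCoprime_of_prime_dvd
    (fun h0 => hQ ((Polynomial.map_eq_zero_iff hinj).mp h0.2)) fun z hz hzP hzQ => ?_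
  -- The primitive part of a denominator-free multiple of `z` is a common divisor of `P` and `Q`.
  set w := (IsLocalization.integerNormalization (nonZeroDivisors D) z).primPart with hw
  obtain ⟨b, hb, hbz⟩ := IsLocalization.integerNormalization_spec (nonZeroDivisors D) z
  have hdvd : w.map (algebraMap D K) ∣ z := by
    have h1 : w.map (algebraMap D K) ∣ b • z := by
      rw [← hbz]
      exact Polynomial.map_dvd _ (primPart_dvd _)
    have hb0 : algebraMap D K b ≠ 0 := by
      simpa using nonZeroDivisors.ne_zero hb
    rw [← algebraMap_smul K b z, Polynomial.smul_eq_C_mul] at h1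
    exact (isUnit_C.mpr hb0.isUnit).dvd_mul_left.mp h1
  have hwP := (isPrimitive_primPart _).dvd_of_fraction_map_dvd_fraction_map (K := K)
    (hdvd.trans hzP)
  have hwQ := (isPrimitive_primPart _).dvd_of_fraction_map_dvd_fraction_map (K := K)
    (hdvd.trans hzQ)
  exact hz.not_isUnit (isUnit_or_eq_zero_of_isUnit_integerNormalization_primPart hz.ne_zero
    (h hwP hwQ))

/-- Regarding both polynomials as forms of the larger of the two degrees multiplies the resultant by
a power of the leading coefficient of the polynomial of larger degree, up to sign. -/
lemma resultant_max_ne_zero {K : Type*} [Field K] {P Q : K[X]} (h : IsCoprime P Q) :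
    resultant P Q (max P.natDegree Q.natDegree) (max P.natDegree Q.natDegree) ≠ 0 := by
  have hR : resultant P Q ≠ 0 := resultant_ne_zero P Q h
  rcases le_total Q.natDegree P.natDegree with hle | hle
  · rw [max_eq_left hle]
    obtain ⟨k, hk⟩ := Nat.exists_eq_add_of_le hle
    conv in resultant _ _ _ _ => rw [show resultant P Q P.natDegree P.natDegree =
      resultant P Q P.natDegree (Q.natDegree + k) by rw [← hk]]
    rw [resultant_add_right_deg _ _ _ _ _ le_rfl]
    refine mul_ne_zero ?_ hR
    rcases eq_or_ne P 0 with rfl | hP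
    · rw [natDegree_zero] at hk
      simp [show k = 0 by lia]
    · exact pow_ne_zero _ (leadingCoeff_ne_zero.mpr hP)
  · rw [max_eq_right hle]
    obtain ⟨k, hk⟩ := Nat.exists_eq_add_of_le hle
    conv in resultant _ _ _ _ => rw [show resultant P Q Q.natDegree Q.natDegree =
      resultant P Q (P.natDegree + k) Q.natDegree by rw [← hk]]
    rw [resultant_add_left_deg _ _ _ _ _ le_rfl]
    refine mul_ne_zero (mul_ne_zero (pow_ne_zero _ (by simp)) ?_) hR
    rcases eq_or_ne Q 0 with rfl | hQ
    · rw [natDegree_zero] at hk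
      simp [show k = 0 by lia]
    · exact pow_ne_zero _ (leadingCoeff_ne_zero.mpr hQ)

lemma den₂_ne_zero (R : RatFunc₂) : den₂ R ≠ 0 :=
  nonZeroDivisors.ne_zero (IsFractionRing.den (Qbar[X][X]) R).2

lemma res₂_ne_zero (R : RatFunc₂) : res₂ R ≠ 0 := by
  let _ : NormalizedGCDMonoid Qbar[X] :=
    (inferInstance : Nonempty (NormalizedGCDMonoid Qbar[X])).some
  have hrel : IsRelPrime (num₂ R) (den₂ R) := IsFractionRing.num_den_reduced _ R
  have hinj : Function.Injective (algebraMap Qbar[X] (RatFunc Qbar)) :=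
    IsFractionRing.injective _ _
  have h := resultant_max_ne_zero
    (isCoprime_map_of_isRelPrime (K := RatFunc Qbar) hrel (den₂_ne_zero R))
  rw [natDegree_map_eq_of_injective hinj, natDegree_map_eq_of_injective hinj,
    resultant_map_map] at h
  exact fun h0 => h (by rw [← map_zero (algebraMap Qbar[X] (RatFunc Qbar)), ← h0]; rfl)

/-! ### Substitution of a rational function -/

lemma polySubst_eq_div (F : Qbar[X][X]) (f : RatFunc Qbar) {d : ℕ} (hF : F.natDegree ≤ d) :
    polySubst F f = algebraMap Qbar[X] (RatFunc Qbar) (homEval F d f.num f.denom) /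
      algebraMap Qbar[X] (RatFunc Qbar) f.denom ^ d := by
  have hB : algebraMap Qbar[X] (RatFunc Qbar) f.denom ≠ 0 :=
    RatFunc.algebraMap_ne_zero f.denom_ne_zero
  rw [eq_div_iff (pow_ne_zero _ hB), polySubst, aeval_eq_sum_range' (Nat.lt_succ_of_le hF),
    homEval, map_sum, Finset.sum_mul]
  refine Finset.sum_congr rfl fun i hi => ?_
  have hi : i ≤ d := Nat.lt_succ_iff.mp (Finset.mem_range.mp hi)
  have hfAB : f = algebraMap Qbar[X] (RatFunc Qbar) f.num /
    algebraMap Qbar[X] (RatFunc Qbar) f.denom := (RatFunc.num_div_denom f).symm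
  generalize f.num = A at *
  generalize f.denom = B at *
  rw [hfAB, Algebra.smul_def, map_mul, map_mul, map_pow, map_pow, div_pow,
    show d = i + (d - i) by lia, pow_add, Nat.add_sub_cancel_left]
  field_simp

lemma natDegree_homEval_le {F : Qbar[X][X]} {A B : Qbar[X]} {d m k : ℕ}
    (hF : ∀ j, (F.coeff j).natDegree ≤ m) (hA : A.natDegree ≤ k) (hB : B.natDegree ≤ k) :
    (homEval F d A B).natDegree ≤ m + d * k := by
  refine natDegree_sum_le_of_forall_le _ _ fun i hi => ?_
  have hi : i ≤ d := Nat.lt_succ_iff.mp (Finset.mem_range.mp hi)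
  calc (F.coeff i * A ^ i * B ^ (d - i)).natDegree
      ≤ (F.coeff i).natDegree + i * A.natDegree + (d - i) * B.natDegree :=
        natDegree_mul_le.trans (add_le_add (natDegree_mul_le.trans
          (add_le_add le_rfl natDegree_pow_le)) natDegree_pow_le)
    _ ≤ m + i * k + (d - i) * k := by gcongr; exact hF i
    _ = m + (i + (d - i)) * k := by ring
    _ = m + d * k := by rw [Nat.add_sub_cancel' hi]

/-- Clearing denominators in `P(z, f(z)) / Q(z, f(z))` gives the numerator and the denominator of
`R(z, f(z))` in lowest terms, times a common factor `G`. -/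
lemma exists_homEval_eq_mul (R : RatFunc₂) (f : RatFunc Qbar) (hf : polySubst (den₂ R) f ≠ 0) :
    ∃ G : Qbar[X], G ≠ 0 ∧
      homEval (num₂ R) (degW R) f.num f.denom = G * (subst₂ R f).num ∧
      homEval (den₂ R) (degW R) f.num f.denom = G * (subst₂ R f).denom := by
  set g := subst₂ R f with hg
  have hB : algebraMap Qbar[X] (RatFunc Qbar) f.denom ≠ 0 :=
    RatFunc.algebraMap_ne_zero f.denom_ne_zero
  have hQ := polySubst_eq_div (den₂ R) f (d := degW R) (le_max_right _ _)
  have hP := polySubst_eq_div (num₂ R) f (d := degW R) (le_max_left _ _)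
  set p := homEval (num₂ R) (degW R) f.num f.denom
  set q := homEval (den₂ R) (degW R) f.num f.denom
  have hq : algebraMap Qbar[X] (RatFunc Qbar) q ≠ 0 := by
    intro h
    rw [h, zero_div] at hQ
    exact hf hQ
  have hq0 : q ≠ 0 := fun h => hq (by rw [h, map_zero])
  have hden : algebraMap Qbar[X] (RatFunc Qbar) g.denom ≠ 0 :=
    RatFunc.algebraMap_ne_zero g.denom_ne_zero
  have hpq : p * g.denom = q * g.num := by
    apply RatFunc.algebraMap_injective Qbar
    have h : g = _ / _ := hg
    rw [hP, hQ, div_div_div_cancel_right₀ (pow_ne_zero _ hB), ← RatFunc.num_div_denom g,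
      div_eq_div_iff hden hq] at h
    rw [map_mul, map_mul, ← h, mul_comm]
  obtain ⟨G, hG⟩ : g.denom ∣ q :=
    (RatFunc.isCoprime_num_denom g).symm.dvd_of_dvd_mul_right ⟨p, by rw [← hpq, mul_comm]⟩
  refine ⟨G, ?_, ?_, by rw [hG, mul_comm]⟩
  · rintro rfl
    exact hq0 (by rw [hG, mul_zero])
  · refine mul_right_cancel₀ g.denom_ne_zero ?_
    rw [hpq, hG]
    ring

lemma natDegree_coeff_le_polyDegZ (F : Qbar[X][X]) (j : ℕ) :
    (F.coeff j).natDegree ≤ polyDegZ F := by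
  by_cases h : F.coeff j = 0
  · simp [h]
  · exact Finset.le_sup (f := fun j => (F.coeff j).natDegree) (mem_support_iff.mpr h)

/-- The common factor `G` of `exists_homEval_eq_mul` divides the resultant, because it divides the
products of the resultant with powers of the coprime polynomials `f.num` and `f.denom`; `S` is the
quotient. -/
lemma exists_elim (R : RatFunc₂) (f : RatFunc Qbar) (hf : polySubst (den₂ R) f ≠ 0)
    (hd : 0 < degW R) :
    ∃ S : Qbar[X], S ≠ 0 ∧ ∀ i : Fin (degW R + degW R),
      S * (f.num ^ (i : ℕ) * f.denom ^ (2 * degW R - 1 - i)) =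
        ((sylvester (num₂ R) (den₂ R) (degW R) (degW R)).updateRow i
          (elimRow (degW R) f.num f.denom (subst₂ R f).num (subst₂ R f).denom)).det := by
  obtain ⟨G, hG0, hP, hQ⟩ := exists_homEval_eq_mul R f hf
  have key := resultant_mul_eq (num₂ R) (den₂ R) (degW R) f.num f.denom G _ _ hP hQ
  have hdvd : G ∣ res₂ R := by
    have hA := key ⟨2 * degW R - 1, by lia⟩
    have hB := key ⟨0, by lia⟩
    simp only [Nat.sub_self, pow_zero, mul_one, one_mul, Nat.sub_zero] at hA hB
    obtain ⟨a, b, hab⟩ := (RatFunc.isCoprime_num_denom f).pow (m := 2 * degW R - 1)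
      (n := 2 * degW R - 1)
    have hres : res₂ R = a * (res₂ R * f.num ^ (2 * degW R - 1)) +
        b * (res₂ R * f.denom ^ (2 * degW R - 1)) := by
      linear_combination (-res₂ R) * hab
    rw [hres]
    exact dvd_add ((Dvd.intro _ hA.symm).mul_left a) ((Dvd.intro _ hB.symm).mul_left b)
  obtain ⟨S, hS⟩ := hdvd
  refine ⟨S, ?_, fun i => mul_left_cancel₀ hG0 ?_⟩
  · rintro rfl
    exact res₂_ne_zero R (by rw [hS, mul_zero])
  · rw [← key i, ← mul_assoc, ← hS]
    rfl

lemma natDegree_subst₂_le (R : RatFunc₂) (f : RatFunc Qbar) (hf : polySubst (den₂ R) f ≠ 0) :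
    (subst₂ R f).num.natDegree ≤ degZ R + degW R * ratDegree f ∧
      (subst₂ R f).denom.natDegree ≤ degZ R + degW R * ratDegree f := by
  obtain ⟨G, hG0, hP, hQ⟩ := exists_homEval_eq_mul R f hf
  have hle (g F : Qbar[X]) (hg : F = G * g) (hF : F.natDegree ≤ degZ R + degW R * ratDegree f) :
      g.natDegree ≤ degZ R + degW R * ratDegree f := by
    rcases eq_or_ne g 0 with rfl | hg0
    · simp
    · rw [hg, natDegree_mul hG0 hg0] at hF
      lia
  exact ⟨hle _ _ hP (natDegree_homEval_le
      (fun j => (natDegree_coeff_le_polyDegZ _ j).trans (le_max_left _ _))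
      (le_max_left _ _) (le_max_right _ _)),
    hle _ _ hQ (natDegree_homEval_le
      (fun j => (natDegree_coeff_le_polyDegZ _ j).trans (le_max_right _ _))
      (le_max_left _ _) (le_max_right _ _))⟩

/-! ### Descent to a number field -/

lemma coeff_num_mem (f : RatFunc Qbar) (i : ℕ) :
    f.num.coeff i ∈ insert 0 (Set.range (ratCoeffs f)) := by
  rcases lt_or_ge i (ratDegree f + 1) with h | h
  · exact Or.inr ⟨Sum.inl ⟨i, h⟩, rfl⟩
  · exact Or.inl (coeff_eq_zero_of_natDegree_lt ((le_max_left _ _).trans_lt h))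

lemma coeff_denom_mem (f : RatFunc Qbar) (i : ℕ) :
    f.denom.coeff i ∈ insert 0 (Set.range (ratCoeffs f)) := by
  rcases lt_or_ge i (ratDegree f + 1) with h | h
  · exact Or.inr ⟨Sum.inr ⟨i, h⟩, rfl⟩
  · exact Or.inl (coeff_eq_zero_of_natDegree_lt ((le_max_right _ _).trans_lt h))

lemma coeff_num₂_mem (R : RatFunc₂) (i j : ℕ) :
    ((num₂ R).coeff j).coeff i ∈ insert 0 (Set.range (coeffs₂ R)) := by
  rcases lt_or_ge j (degW R + 1) with hj | hj
  · rcases lt_or_ge i (degZ R + 1) with hi | hi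
    · exact Or.inr ⟨Sum.inl (⟨j, hj⟩, ⟨i, hi⟩), rfl⟩
    · exact Or.inl (coeff_eq_zero_of_natDegree_lt (((natDegree_coeff_le_polyDegZ _ j).trans
        (le_max_left _ _)).trans_lt hi))
  · left
    rw [coeff_eq_zero_of_natDegree_lt (p := num₂ R) ((le_max_left _ _).trans_lt hj), coeff_zero]

lemma coeff_den₂_mem (R : RatFunc₂) (i j : ℕ) :
    ((den₂ R).coeff j).coeff i ∈ insert 0 (Set.range (coeffs₂ R)) := by
  rcases lt_or_ge j (degW R + 1) with hj | hj
  · rcases lt_or_ge i (degZ R + 1) with hi | hi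
    · exact Or.inr ⟨Sum.inr (⟨j, hj⟩, ⟨i, hi⟩), rfl⟩
    · exact Or.inl (coeff_eq_zero_of_natDegree_lt (((natDegree_coeff_le_polyDegZ _ j).trans
        (le_max_right _ _)).trans_lt hi))
  · left
    rw [coeff_eq_zero_of_natDegree_lt (p := den₂ R) ((le_max_right _ _).trans_lt hj), coeff_zero]

lemma ratCoeffs_ne_zero (f : RatFunc Qbar) : ratCoeffs f ≠ 0 := by
  intro h
  apply f.denom_ne_zero
  ext i
  rcases coeff_denom_mem f i with hi | ⟨t, ht⟩
  · simpa using hi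
  · rw [← ht, h]; simp

lemma coeffs₂_ne_zero (R : RatFunc₂) : coeffs₂ R ≠ 0 := by
  intro h
  apply den₂_ne_zero R
  ext j i
  rcases coeff_den₂_mem R i j with hi | ⟨t, ht⟩
  · simpa using hi
  · rw [← ht, h]; simp

lemma exists_map_eq (L : IntermediateField ℚ Qbar) {F : Qbar[X]} (hF : ∀ i, F.coeff i ∈ L) :
    ∃ F' : L[X], F'.map (algebraMap L Qbar) = F :=
  (lifts_iff_coeff_lifts F).mpr fun i => ⟨⟨_, hF i⟩, rfl⟩

lemma exists_map_map_eq (L : IntermediateField ℚ Qbar) {F : Qbar[X][X]}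
    (hF : ∀ i j, (F.coeff j).coeff i ∈ L) :
    ∃ F' : L[X][X], F'.map (mapRingHom (algebraMap L Qbar)) = F :=
  (lifts_iff_coeff_lifts F).mpr fun j => exists_map_eq L fun i => hF i j

/-- The height inequality with the constant that comes out of the local estimates. -/
lemma ratHeight_le (R : RatFunc₂) (f : RatFunc Qbar) (hf : polySubst (den₂ R) f ≠ 0) {e : ℕ}
    (hd : degW R = e + 1) :
    ((e + 1 : ℕ) : ℝ) * ratHeight f ≤ ratHeight (subst₂ R f) + ((2 * e + 1 : ℕ) : ℝ) * height₂ R +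
      Real.log (archConst e (degZ R) (ratDegree f) (degZ R + (e + 1) * ratDegree f)) := by
  obtain ⟨S, hS0, hS⟩ := exists_elim R f hf (by lia)
  obtain ⟨hg₁n, hg₀n⟩ := natDegree_subst₂_le R f hf
  rw [hd] at hS hg₁n hg₀n
  set g := subst₂ R f
  -- A number field that contains all coefficients that occur.
  set T : Set Qbar := Set.range (ratCoeffs f) ∪ Set.range (coeffs₂ R) ∪ Set.range (ratCoeffs g) ∪
    S.coeffs with hT
  have hTfin : Finite T := by
    refine Set.Finite.to_subtype ?_
    exact (((Set.finite_range _).union (Set.finite_range _)).union (Set.finite_range _)).union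
      (Finset.finite_toSet _)
  let L : IntermediateField ℚ Qbar := IntermediateField.adjoin ℚ T
  have : NumberField L :=
    { to_finiteDimensional := IntermediateField.finiteDimensional_adjoin
        fun y _ => (Algebra.IsAlgebraic.isAlgebraic (R := ℚ) y).isIntegral }
  have hTL : T ⊆ L := IntermediateField.subset_adjoin ℚ T
  have hmem {ι : Type} {u : ι → Qbar} (hu : Set.range u ⊆ T) {a : Qbar}
      (ha : a ∈ insert 0 (Set.range u)) : a ∈ L := by
    rcases ha with rfl | ha
    · exact zero_mem L
    · exact hTL (hu ha)
  have hfT : Set.range (ratCoeffs f) ⊆ T := fun a ha => Or.inl (Or.inl (Or.inl ha))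
  have hRT : Set.range (coeffs₂ R) ⊆ T := fun a ha => Or.inl (Or.inl (Or.inr ha))
  have hgT : Set.range (ratCoeffs g) ⊆ T := fun a ha => Or.inl (Or.inr ha)
  obtain ⟨A, hA⟩ := exists_map_eq L fun i => hmem hfT (coeff_num_mem f i)
  obtain ⟨B, hB⟩ := exists_map_eq L fun i => hmem hfT (coeff_denom_mem f i)
  obtain ⟨g₁, hg₁⟩ := exists_map_eq L fun i => hmem hgT (coeff_num_mem g i)
  obtain ⟨g₀, hg₀⟩ := exists_map_eq L fun i => hmem hgT (coeff_denom_mem g i)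
  obtain ⟨P, hP⟩ := exists_map_map_eq L fun i j => hmem hRT (coeff_num₂_mem R i j)
  obtain ⟨Q, hQ⟩ := exists_map_map_eq L fun i j => hmem hRT (coeff_den₂_mem R i j)
  obtain ⟨S', hS'⟩ : ∃ S' : L[X], S'.map (algebraMap L Qbar) = S := by
    refine exists_map_eq L fun i => ?_
    by_cases h : S.coeff i = 0
    · rw [h]; exact zero_mem L
    · exact hTL (Or.inr (coeff_mem_coeffs h))
  let x : _ → L := fun t => ⟨ratCoeffs f t, hTL (hfT ⟨t, rfl⟩)⟩
  let y : _ → L := fun t => ⟨coeffs₂ R t, hTL (hRT ⟨t, rfl⟩)⟩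
  let z : _ → L := fun t => ⟨ratCoeffs g t, hTL (hgT ⟨t, rfl⟩)⟩
  have hinj : Function.Injective (algebraMap L Qbar) := (algebraMap L Qbar).injective
  have hne {ι : Type} {u : ι → Qbar} {u' : ι → L} (h : ∀ t, (u' t : Qbar) = u t) (hu : u ≠ 0) :
      u' ≠ 0 := by
    rintro rfl
    exact hu (funext fun t => (h t).symm)
  have hpull {ι : Type} {u : ι → Qbar} {u' : ι → L} (h : ∀ t, (u' t : Qbar) = u t) {a : L}
      (ha : (a : Qbar) ∈ insert 0 (Set.range u)) : a ∈ insert 0 (Set.range u') := by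
    rcases ha with ha | ⟨t, ht⟩
    · exact Or.inl (Subtype.ext ha)
    · exact Or.inr ⟨t, Subtype.ext ((h t).trans ht)⟩
  have hcoeff {F : L[X]} {F' : Qbar[X]} (h : F.map (algebraMap L Qbar) = F') (i : ℕ) :
      (F.coeff i : Qbar) = F'.coeff i := by
    rw [← h, coeff_map]; rfl
  have hcoeff₂ {F : L[X][X]} {F' : Qbar[X][X]} (h : F.map (mapRingHom (algebraMap L Qbar)) = F')
      (j : ℕ) : (F.coeff j).map (algebraMap L Qbar) = F'.coeff j := by
    rw [← h, coeff_map]; rfl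
  have hdeg {F : L[X]} {F' : Qbar[X]} (h : F.map (algebraMap L Qbar) = F') :
      F.natDegree = F'.natDegree := by
    rw [← h, natDegree_map]
  have hSL (i : Fin ((e + 1) + (e + 1))) : S' * (A ^ (i : ℕ) * B ^ (2 * (e + 1) - 1 - i)) =
      ((sylvester P Q (e + 1) (e + 1)).updateRow i (elimRow (e + 1) A B g₁ g₀)).det := by
    apply Polynomial.map_injective _ hinj
    rw [map_det_updateRow_elimRow, hP, hQ, hA, hB, hg₁, hg₀, ← hS i]
    simp only [Polynomial.map_mul, Polynomial.map_pow, hA, hB, hS']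
  have hS'0 : S' ≠ 0 := by
    rintro rfl
    exact hS0 (by rw [← hS', Polynomial.map_zero])
  have main := mulHeight_elim_le (e := e) (m := degZ R) (k := ratDegree f)
    (n := degZ R + (e + 1) * ratDegree f) (x := x) (y := y) (z := z) hS'0 hSL
    (fun j => (hdeg (hcoeff₂ hP j)).trans_le
      ((natDegree_coeff_le_polyDegZ _ j).trans (le_max_left _ _)))
    (fun j => (hdeg (hcoeff₂ hQ j)).trans_le
      ((natDegree_coeff_le_polyDegZ _ j).trans (le_max_right _ _)))
    ((hdeg hA).trans_le (le_max_left _ _)) ((hdeg hB).trans_le (le_max_right _ _))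
    ((hdeg hg₁).trans_le hg₁n) ((hdeg hg₀).trans_le hg₀n)
    (hne (fun _ => rfl) (ratCoeffs_ne_zero f)) (hne (fun _ => rfl) (coeffs₂_ne_zero R))
    (hne (fun _ => rfl) (ratCoeffs_ne_zero g))
    (fun i j => hpull (fun _ => rfl) (hcoeff (hcoeff₂ hP j) i ▸ coeff_num₂_mem R i j))
    (fun i j => hpull (fun _ => rfl) (hcoeff (hcoeff₂ hQ j) i ▸ coeff_den₂_mem R i j))
    (fun i => hpull (fun _ => rfl) (hcoeff hA i ▸ coeff_num_mem f i))
    (fun i => hpull (fun _ => rfl) (hcoeff hB i ▸ coeff_denom_mem f i))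
    (fun i => hpull (fun _ => rfl) (hcoeff hg₁ i ▸ coeff_num_mem g i))
    (fun i => hpull (fun _ => rfl) (hcoeff hg₀ i ▸ coeff_denom_mem g i))
    (fun t => by
      rcases t with t | t
      · exact Or.inl ⟨t, Subtype.ext (hcoeff hA t)⟩
      · exact Or.inr ⟨t, Subtype.ext (hcoeff hB t)⟩)
  have hC : 0 < archConst e (degZ R) (ratDegree f) (degZ R + (e + 1) * ratDegree f) := by
    unfold archConst; positivity
  have hlog := Real.log_le_log (pow_pos (Height.mulHeight_pos x) _) main
  rw [Real.log_mul (pow_pos hC _).ne' (mul_pos (pow_pos (Height.mulHeight_pos y) _)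
      (Height.mulHeight_pos z)).ne',
    Real.log_mul (pow_pos (Height.mulHeight_pos y) _).ne' (Height.mulHeight_pos z).ne',
    Real.log_pow, Real.log_pow, Real.log_pow, ← Height.logHeight_eq_log_mulHeight,
    ← Height.logHeight_eq_log_mulHeight, ← Height.logHeight_eq_log_mulHeight,
    NumberField.totalWeight_eq_finrank] at hlog
  have hpos : (0 : ℝ) < Module.finrank ℚ L := by
    exact_mod_cast Module.finrank_pos (R := ℚ) (M := L)
  have h1 : ratHeight f = Height.logHeight x / Module.finrank ℚ L := absLogHeight_eq L x
  have h2 : height₂ R = Height.logHeight y / Module.finrank ℚ L := absLogHeight_eq L y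
  have h3 : ratHeight g = Height.logHeight z / Module.finrank ℚ L := absLogHeight_eq L z
  rw [h1, h2, h3]
  refine le_of_mul_le_mul_right ?_ hpos
  field_simp
  linarith

lemma archConst_le {e m k : ℕ} : archConst e m k (m + (e + 1) * k) ≤
    (2 * e + 1).factorial * 2 ^ (4 * (e + 1) * m + (6 * e + 3) * k + 1) := by
  have hpow (a : ℕ) : (a : ℝ) + 1 ≤ 2 ^ a := by
    exact_mod_cast Nat.lt_two_pow_self (n := a)
  have hn := hpow (m + (e + 1) * k)
  calc archConst e m k (m + (e + 1) * k)
      ≤ 2 * (2 * e + 1).factorial * (2 ^ m) ^ (2 * e + 1) * (2 ^ k) ^ e *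
          2 ^ (m + (e + 1) * k) * 2 ^ (k * (2 * e + 1)) := by
        unfold archConst
        gcongr
        · exact hpow m
        · exact hpow k
    _ = (2 * e + 1).factorial * 2 ^ (1 + m * (2 * e + 1) + k * e + (m + (e + 1) * k) +
          k * (2 * e + 1)) := by
        rw [← pow_mul, ← pow_mul]
        simp only [pow_add, pow_one]
        ring
    _ ≤ _ := by
        refine mul_le_mul_of_nonneg_left (pow_le_pow_right₀ one_le_two ?_) (by positivity)
        nlinarith [Nat.zero_le (e * m), Nat.zero_le (e * k)]

end WeilHeight

theorem mainTheorem4 (R : WeilHeight.RatFunc₂) (hd : 2 ≤ WeilHeight.degW R)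
    (f : RatFunc Qbar) (hf : WeilHeight.polySubst (WeilHeight.den₂ R) f ≠ 0) :
    (WeilHeight.degW R : ℝ) * WeilHeight.ratHeight f
      ≤ WeilHeight.ratHeight (WeilHeight.subst₂ R f)
        + WeilHeight.heightError R (WeilHeight.ratDegree f) := by
  obtain ⟨e, he⟩ : ∃ e, WeilHeight.degW R = e + 1 := ⟨WeilHeight.degW R - 1, by lia⟩
  have h := WeilHeight.ratHeight_le R f hf he
  have hC := Real.log_le_log (by unfold WeilHeight.archConst; positivity)
    (WeilHeight.archConst_le (e := e) (m := WeilHeight.degZ R) (k := WeilHeight.ratDegree f))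
  rw [Real.log_mul (by positivity) (by positivity), Real.log_pow] at hC
  have hres : 0 ≤ ((WeilHeight.res₂ R).natDegree : ℝ) * Real.log 2 :=
    mul_nonneg (Nat.cast_nonneg _) (Real.log_nonneg one_le_two)
  rw [WeilHeight.heightError, he, show 2 * (e + 1) - 1 = 2 * e + 1 by lia]
  push_cast at h hC ⊢
  linarith
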